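/- \textbf{Theorem.} Let $E$ be a field of characteristic different from $2$ that is finitely generated (as a field) over its prime field, and fix an algebraic closure of $E$. Let $E_{\mathrm{pyth}}$ (the pythagorean closure of $E$) be the union, inside this algebraic closure, of all fields obtained from $E$ by finitely many steps, each adjoining a square root of a sum of two squares of elements of the preceding field; let $E_{\mathrm{quad}}$ (the quadratic closure of $E$) be defined in the same way, each step adjoining a square root of an arbitrary element of the preceding field. (1) If $E$ contains a global field (that is, a number field or a function field in one variable over a finite field), then $E_{\mathrm{pyth}}$ and $E_{\mathrm{quad}}$ are both hereditarily non-pythagorean. (2) Otherwise, $E$ is a finite field and $E_{\mathrm{pyth}}$ is hereditarily quadratically closed. Here a field is \emph{pythagorean} if every sum of squares in it is a square, and \emph{quadratically closed} if every element is a square. A field $k$ is \emph{hereditarily non-pythagorean} if every proper finite extension $F/k$ that is not purely inseparable is non-pythagorean, and \emph{hereditarily quadratically closed} if every finite extension of $k$ (including $k$ itself) is quadratically closed. -/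

import Mathlib

open scoped IntermediateField

universe u v

/-- A field is pythagorean if every sum of squares is a square. -/
def IsPythagorean (K : Type u) [Field K] : Prop :=
  ∀ a : K, IsSumSq a → IsSquare a

/-- A field is quadratically closed if every element is a square. -/
def IsQuadraticallyClosed (K : Type u) [Field K] : Prop :=
  ∀ a : K, IsSquare a

/-- A field `k` is hereditarily non-pythagorean if every proper finite extension `F` of `k` that
is not purely inseparable over `k` is non-pythagorean. -/
def IsHereditarilyNonPythagorean (k : Type u) [Field k] : Prop :=
  ∀ (F : Type u) [Field F] [Algebra k F], FiniteDimensional k F → 1 < Module.finrank k F →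
    ¬ IsPurelyInseparable k F → ¬ IsPythagorean F

/-- A field `k` is hereditarily quadratically closed if every finite extension of `k`
(including `k` itself) is quadratically closed. -/
def IsHereditarilyQuadraticallyClosed (k : Type u) [Field k] : Prop :=
  ∀ (F : Type u) [Field F] [Algebra k F], FiniteDimensional k F → IsQuadraticallyClosed F

section Closures

variable (E : Type u) [Field E] (Ω : Type v) [Field Ω] [Algebra E Ω]

/-- The subfields of `Ω` obtained from `E` in finitely many steps, each of which adjoins a square
root of a sum of two squares of elements of the preceding field. -/
inductive IsPythagoreanTower : IntermediateField E Ω → Prop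
  | base : IsPythagoreanTower ⊥
  | step (K : IntermediateField E Ω) (a b x : Ω) : IsPythagoreanTower K → a ∈ K → b ∈ K →
      x ^ 2 = a ^ 2 + b ^ 2 → IsPythagoreanTower (K ⊔ E⟮x⟯)

/-- The subfields of `Ω` obtained from `E` in finitely many steps, each of which adjoins a square
root of an element of the preceding field. -/
inductive IsQuadraticTower : IntermediateField E Ω → Prop
  | base : IsQuadraticTower ⊥
  | step (K : IntermediateField E Ω) (a x : Ω) : IsQuadraticTower K → a ∈ K →
      x ^ 2 = a → IsQuadraticTower (K ⊔ E⟮x⟯)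

/-- The pythagorean closure of `E` inside `Ω` (for `Ω` an algebraic closure of `E`): the compositum
of all finite towers as above. This family is directed, so that it is also
their union, see `mem_pythagoreanClosure_iff`. -/
def pythagoreanClosure : IntermediateField E Ω :=
  ⨆ K : {K : IntermediateField E Ω // IsPythagoreanTower E Ω K}, K.1

/-- The quadratic closure of `E` inside `Ω` (for `Ω` an algebraic closure of `E`): the compositum
of all finite towers as above. This family is directed, so that it is also
their union, see `mem_quadraticClosure_iff`. -/
def quadraticClosure : IntermediateField E Ω :=
  ⨆ K : {K : IntermediateField E Ω // IsQuadraticTower E Ω K}, K.1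

variable {E Ω}

theorem IsPythagoreanTower.sup {K L : IntermediateField E Ω} (hK : IsPythagoreanTower E Ω K)
    (hL : IsPythagoreanTower E Ω L) : IsPythagoreanTower E Ω (K ⊔ L) := by
  induction hL with
  | base => simpa using hK
  | step L a b x _ ha hb hx ih =>
    rw [← sup_assoc]
    exact .step (K ⊔ L) a b x ih ((le_sup_right : L ≤ K ⊔ L) ha) ((le_sup_right : L ≤ K ⊔ L) hb) hx

theorem IsQuadraticTower.sup {K L : IntermediateField E Ω} (hK : IsQuadraticTower E Ω K)
    (hL : IsQuadraticTower E Ω L) : IsQuadraticTower E Ω (K ⊔ L) := by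
  induction hL with
  | base => simpa using hK
  | step L a x _ ha hx ih =>
    rw [← sup_assoc]
    exact .step (K ⊔ L) a x ih ((le_sup_right : L ≤ K ⊔ L) ha) hx

theorem mem_pythagoreanClosure_iff {y : Ω} :
    y ∈ pythagoreanClosure E Ω ↔ ∃ K, IsPythagoreanTower E Ω K ∧ y ∈ K := by
  have : Nonempty {K : IntermediateField E Ω // IsPythagoreanTower E Ω K} := ⟨⟨⊥, .base⟩⟩
  have hd : Directed (· ≤ ·)
      fun K : {K : IntermediateField E Ω // IsPythagoreanTower E Ω K} => K.1 :=
    fun K L => ⟨⟨K.1 ⊔ L.1, K.2.sup L.2⟩, le_sup_left, le_sup_right⟩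
  rw [pythagoreanClosure, ← SetLike.mem_coe, IntermediateField.coe_iSup_of_directed hd]
  simp

theorem mem_quadraticClosure_iff {y : Ω} :
    y ∈ quadraticClosure E Ω ↔ ∃ K, IsQuadraticTower E Ω K ∧ y ∈ K := by
  have : Nonempty {K : IntermediateField E Ω // IsQuadraticTower E Ω K} := ⟨⟨⊥, .base⟩⟩
  have hd : Directed (· ≤ ·)
      fun K : {K : IntermediateField E Ω // IsQuadraticTower E Ω K} => K.1 :=
    fun K L => ⟨⟨K.1 ⊔ L.1, K.2.sup L.2⟩, le_sup_left, le_sup_right⟩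
  rw [quadraticClosure, ← SetLike.mem_coe, IntermediateField.coe_iSup_of_directed hd]
  simp

end Closures

/-- A global field is a number field or a function field in one variable over a finite field `k`,
that is, a finite extension of the rational function field over `k`. Every finite field has a copy
in `Type`. -/
def IsGlobalField (K : Type u) [Field K] : Prop :=
  NumberField K ∨
    ∃ (k : Type) (_ : Field k) (_ : Finite k) (_ : Algebra (RatFunc k) K), FunctionField k K

/-- The field `E` contains a global field as a subfield. -/
def ContainsGlobalField (E : Type u) [Field E] : Prop :=
  ∃ K : Subfield E, IsGlobalField K

/-! Part (1) uses only that `E` is infinite and that both closures are stable under the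
automorphisms of `Ω` over `E`. Such an `E` is finite over the fraction field `E₀` of `A = ℤ` or `A =
K[X]`. Suppose a stable `k` had a pythagorean finite extension `F`, not purely inseparable. Two
`k`-embeddings `φ₁`, `φ₂` of `F` into `Ω` then differ at some `α` with images separable over `E₀`.
For each `c` in `A`, `1 + (α + c)² = y²` in `F`. Automorphisms fixing suitable finitely many
elements change `φ₁ y` and `φ₂ y` by the same sign, so `(1 + (φ₁ α + c)²)(1 + (φ₂ α + c)²)` is a
square in a finite separable `N/E₀` independent of `c`. As a polynomial in `c` this has a simple
root in `N`. At a place of `N` unramified of degree one over `A`, some `c` makes its valuation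
exactly `1`, a contradiction (`UnitsSeparated.exists_not_isSquare`).

For part (2), an infinite finitely generated `E` contains `ℚ` or some `𝔽_p(t)`, so `E` must be
finite. Sums of two squares exhaust a finite field, so the pythagorean closure is quadratically
closed. This passes to finite extensions because their nonzero elements are roots of unity. -/

open Polynomial

/-! ### Roots of polynomials modulo maximal ideals -/

/-- The units of `A` are pairwise incongruent modulo infinitely many elements of `A`. -/
def UnitsSeparated (A : Type*) [CommRing A] : Prop :=
  ∃ S : Set A, S.Infinite ∧ ∀ x ∈ S, ∀ u v : A, IsUnit u → IsUnit v → x ∣ u - v → u = v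

/-- If all values were units, `f(x)` and `f(0)`, congruent modulo `x`, would agree for the
infinitely many `x` in `S`. -/
theorem UnitsSeparated.exists_not_isUnit_eval {A : Type*} [CommRing A] [IsDomain A]
    (hA : UnitsSeparated A) (f : A[X]) (hf : f ≠ C (f.eval 0)) : ∃ x, ¬ IsUnit (f.eval x) := by
  obtain ⟨S, hS, h⟩ := hA
  by_contra! hu
  refine hf (eq_of_infinite_eval_eq _ _ (hS.mono fun x hx => ?_))
  have := h x hx _ _ (hu x) (hu 0) (by simpa using sub_dvd_eval_sub x 0 f)
  simpa using this

theorem UnitsSeparated.infinite {A : Type*} [CommRing A] (hA : UnitsSeparated A) : Infinite A := by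
  obtain ⟨S, hS, -⟩ := hA
  exact Set.infinite_univ_iff.1 (hS.mono (Set.subset_univ _))

/-- A nonconstant polynomial has a root modulo a maximal ideal avoiding a given nonzero element. -/
theorem UnitsSeparated.exists_isMaximal_eval_mem {A : Type*} [CommRing A] [IsDomain A]
    (hA : UnitsSeparated A) (h : A[X]) (hh : 0 < h.natDegree) {D : A} (hD : D ≠ 0) :
    ∃ P : Ideal A, P.IsMaximal ∧ D ∉ P ∧ ∃ b, h.eval b ∈ P := by
  have := hA.infinite
  obtain ⟨b₀, hb₀⟩ : ∃ b, h.eval b ≠ 0 := by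
    by_contra! H
    have : h = 0 := Polynomial.funext fun x => by simp [H]
    simp [this] at hh
  -- Euclid's argument: substituting `b₀ + D h(b₀) x` splits off the factor `h(b₀)` and leaves a
  -- polynomial `f` congruent to `1` modulo `D`. A maximal ideal containing a nonunit value of `f`
  -- therefore avoids `D`.
  set g := divX (taylor b₀ h) with hg
  set c := D * h.eval b₀ with hc
  have hc0 : c ≠ 0 := mul_ne_zero hD hb₀
  have hg0 : g ≠ 0 := by
    intro h0
    rw [divX_eq_zero_iff] at h0
    have := congrArg natDegree h0
    simp at this
    omega
  have key (x : A) : h.eval (b₀ + c * x) = h.eval b₀ * (1 + x * (D * g.eval (c * x))) := by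
    have h1 : (taylor b₀ h).eval (c * x) = h.eval (b₀ + c * x) := by
      rw [taylor_eval, add_comm]
    have h2 := congrArg (eval (c * x)) (divX_mul_X_add (taylor b₀ h))
    rw [← h1, ← h2]
    simp only [eval_add, eval_mul, eval_X, eval_C, taylor_coeff_zero, ← hg]
    rw [hc]; ring
  set f : A[X] := 1 + X * (C D * g.comp (C c * X)) with hf
  have hf1 : f ≠ C (f.eval 0) := by
    intro h0
    have : g.comp (C c * X) = 0 := by simpa [hf, hD] using h0
    rw [comp_C_mul_X_eq_zero_iff (by simpa using hc0)] at this
    exact hg0 this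
  obtain ⟨x, hx⟩ := hA.exists_not_isUnit_eval f hf1
  have hfx : f.eval x = 1 + x * (D * g.eval (c * x)) := by simp [hf]
  obtain ⟨P, hP, hle⟩ := Ideal.exists_le_maximal (Ideal.span {f.eval x})
    (by rwa [Ne, Ideal.span_singleton_eq_top])
  have hmem : f.eval x ∈ P := hle (Ideal.mem_span_singleton_self _)
  refine ⟨P, hP, fun hDP => hP.ne_top ((Ideal.eq_top_iff_one _).2 ?_), b₀ + c * x, ?_⟩
  · have : (1 : A) = f.eval x - D * (x * g.eval (c * x)) := by rw [hfx]; ring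
    rw [this]
    exact P.sub_mem hmem (P.mul_mem_right _ hDP)
  · rw [key, ← hfx]
    exact P.mul_mem_left _ hmem

/-- Two units differ by `0` or `±2`, so every modulus above `2` separates them. -/
theorem UnitsSeparated.int : UnitsSeparated ℤ := by
  refine ⟨Set.Ioi 2, Set.Ioi_infinite _, fun x hx u v hu hv h => ?_⟩
  have hx' : 2 < x := hx
  by_contra huv
  have h2 : x ∣ 2 := by
    rcases Int.isUnit_iff.1 hu with rfl | rfl <;> rcases Int.isUnit_iff.1 hv with rfl | rfl
    · exact absurd rfl huv
    · simpa using h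
    · exact (dvd_neg).1 (by simpa using h)
    · exact absurd rfl huv
  have := Int.le_of_dvd (by norm_num) h2
  omega

theorem UnitsSeparated.polynomial (K : Type*) [Field K] : UnitsSeparated K[X] := by
  refine ⟨Set.range fun n : ℕ => (X : K[X]) ^ (n + 1), Set.infinite_range_of_injective ?_, ?_⟩
  · intro m n h
    have := congrArg natDegree h
    simpa using this
  · rintro _ ⟨n, rfl⟩ u v hu hv h
    obtain ⟨a, -, rfl⟩ := Polynomial.isUnit_iff.1 hu
    obtain ⟨b, -, rfl⟩ := Polynomial.isUnit_iff.1 hv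
    have h1 := dvd_trans (dvd_pow_self X n.succ_ne_zero) h
    rw [X_dvd_iff] at h1
    simp only [coeff_sub, coeff_C_zero, sub_eq_zero] at h1
    rw [h1]

/-! ### Unramified places of degree one -/

/-- For `N` finite separable over the fraction field of `A`, there are an order `R` of `N` and a
point `ψ` of `R` with values in a residue field of `A` such that `R` is unramified over `A` at `ψ`
and finitely many given elements of `N` are regular at `ψ`. -/
theorem UnitsSeparated.exists_unramified_point {A : Type*} [CommRing A] [IsDomain A]
    [IsPrincipalIdealRing A] (hA : UnitsSeparated A) (hAf : ¬ IsField A)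
    (E₀ : Type*) [Field E₀] [Algebra A E₀] [IsFractionRing A E₀]
    (N : Type*) [Field N] [Algebra E₀ N] [Algebra A N] [IsScalarTower A E₀ N]
    [FiniteDimensional E₀ N] [Algebra.IsSeparable E₀ N] (T : Finset N) :
    ∃ (R : Subalgebra A N) (π D : A) (ψ : R →ₐ[A] A ⧸ Ideal.span {π}),
      IsFractionRing R N ∧ IsNoetherianRing R ∧ Prime π ∧ ψ (algebraMap A R D) ≠ 0 ∧
      (∀ t ∈ T, D • t ∈ R) ∧
      ∀ x, ψ x = 0 → ∃ s, ψ s ≠ 0 ∧ algebraMap A R π ∣ s * x := by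
  classical
  obtain ⟨β', hβ'⟩ := Field.exists_primitive_element E₀ N
  have hinj : Function.Injective (algebraMap A N) := by
    rw [IsScalarTower.algebraMap_eq A E₀ N]
    exact (algebraMap E₀ N).injective.comp (IsFractionRing.injective A E₀)
  have : FaithfulSMul A N := (faithfulSMul_iff_algebraMap_injective A N).2 hinj
  have halg : Algebra.IsAlgebraic A N :=
    (IsFractionRing.comap_isAlgebraic_iff (K := E₀)).2 inferInstance
  obtain ⟨a₀, ha₀, hint⟩ := (halg.isAlgebraic β').exists_integral_multiple
  set β := a₀ • β' with hβdef
  have hβ : E₀⟮β⟯ = ⊤ := by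
    rw [eq_top_iff, ← hβ', IntermediateField.adjoin_simple_le_iff]
    have h1 : β ∈ E₀⟮β⟯ := IntermediateField.mem_adjoin_simple_self _ _
    have h2 : β' = (algebraMap A E₀ a₀)⁻¹ • β := by
      rw [hβdef, ← algebraMap_smul E₀ a₀ β', smul_smul, inv_mul_cancel₀, one_smul]
      simpa using ha₀
    rw [h2]
    exact E₀⟮β⟯.smul_mem h1
  set h := minpoly A β with hh
  have hmap : minpoly E₀ β = h.map (algebraMap A E₀) := by
    simpa using minpoly.isIntegrallyClosed_eq_field_fractions E₀ N hint
  set R := Algebra.adjoin A {β} with hR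
  have hβR : β ∈ R := Algebra.self_mem_adjoin_singleton A β
  have hRmem (p : A[X]) : aeval β p ∈ R := by
    rw [hR, Algebra.adjoin_singleton_eq_range_aeval]
    exact ⟨p, rfl⟩
  have hfrac (z : N) : ∃ a : A, a ≠ 0 ∧ a • z ∈ R := by
    have hz : z ∈ E₀⟮β⟯.toSubalgebra := by simp [hβ]
    rw [IntermediateField.adjoin_simple_toSubalgebra_of_isAlgebraic
      (Algebra.IsAlgebraic.isAlgebraic β), Algebra.adjoin_singleton_eq_range_aeval] at hz
    obtain ⟨p, rfl⟩ := hz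
    obtain ⟨a, ha, hp⟩ := IsLocalization.integerNormalization_spec (nonZeroDivisors A) p
    refine ⟨a, nonZeroDivisors.ne_zero ha, ?_⟩
    have : a • aeval β p = aeval β (IsLocalization.integerNormalization (nonZeroDivisors A) p) := by
      rw [← aeval_map_algebraMap E₀ β (IsLocalization.integerNormalization _ p), hp,
        ← algebraMap_smul E₀ a p, map_smul, algebraMap_smul]
    simp only [AlgHom.toRingHom_eq_coe, RingHom.coe_coe]
    rw [this]
    exact hRmem _
  have hder : aeval β (derivative h) ≠ 0 := by
    have h1 := Separable.aeval_derivative_ne_zero (Algebra.IsSeparable.isSeparable E₀ β)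
      (minpoly.aeval E₀ β)
    rwa [hmap, derivative_map, aeval_map_algebraMap] at h1
  choose d hd0 hdR using hfrac
  -- Including `h'(β)⁻¹` among the elements cleared by `D` forces `h'(β)` to be nonzero at any point
  -- where `D` is.
  set D := ∏ t ∈ insert (aeval β (derivative h))⁻¹ T, d t with hD
  have hD0 : D ≠ 0 := Finset.prod_ne_zero_iff.2 fun t _ => hd0 t
  have hDR : ∀ t ∈ insert (aeval β (derivative h))⁻¹ T, D • t ∈ R := by
    intro t ht
    rw [hD, ← Finset.prod_erase_mul _ _ ht, mul_smul]
    exact R.smul_mem (hdR t) _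
  obtain ⟨P, hP, hDP, b, hb⟩ := hA.exists_isMaximal_eval_mem h (minpoly.natDegree_pos hint) hD0
  have hP0 : P ≠ ⊥ := Ring.ne_bot_of_isMaximal_of_not_isField hP hAf
  obtain ⟨π, rfl⟩ : ∃ π, P = Ideal.span {π} :=
    ⟨_, (Ideal.span_singleton_generator P).symm⟩
  have hπ0 : π ≠ 0 := by
    rintro rfl
    simp at hP0
  have hπ : Prime π := (Ideal.span_singleton_prime hπ0).1 hP.isPrime
  have hev : eval₂ (algebraMap A (A ⧸ Ideal.span {π})) (algebraMap A _ b) h = 0 := by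
    rw [eval₂_at_apply]
    exact Ideal.Quotient.eq_zero_iff_mem.2 hb
  -- As `A` is integrally closed, `R ≅ A[X]/(h)`, so the root `b` of `h` modulo `π` defines a point
  -- `β ↦ b`.
  set ψ : R →ₐ[A] A ⧸ Ideal.span {π} :=
    (AdjoinRoot.liftAlgHom h (Algebra.ofId A _) (algebraMap A _ b) hev).comp
      (minpoly.equivAdjoin hint).symm.toAlgHom with hψ
  have hψβ : ψ ⟨β, hβR⟩ = algebraMap A _ b := by
    have : (minpoly.equivAdjoin hint).symm ⟨β, hβR⟩ = AdjoinRoot.root h := by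
      rw [AlgEquiv.symm_apply_eq]
      exact Subtype.ext (AdjoinRoot.Minpoly.coe_toAdjoin_mk_X (R := A) (x := β)).symm
    simp [hψ, this]
  have hψA (a : A) : ψ (algebraMap A R a) = 0 ↔ π ∣ a := by
    rw [AlgHom.commutes, ← Ideal.mem_span_singleton]
    exact Ideal.Quotient.eq_zero_iff_mem
  have hψD : ψ (algebraMap A R D) ≠ 0 := by
    rwa [Ne, hψA, ← Ideal.mem_span_singleton]
  have hψp (p : A[X]) : ψ (aeval ⟨β, hβR⟩ p) = algebraMap A _ (p.eval b) := by
    rw [← aeval_algHom_apply, hψβ, aeval_algebraMap_apply_eq_algebraMap_eval]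
  have hRp (x : R) : ∃ p : A[X], x = aeval ⟨β, hβR⟩ p := by
    obtain ⟨x, hx⟩ := x
    have hx' := hx
    rw [hR, Algebra.adjoin_singleton_eq_range_aeval] at hx'
    obtain ⟨p, hp⟩ := hx'
    refine ⟨p, Subtype.ext ?_⟩
    rw [← Subalgebra.coe_val, ← aeval_algHom_apply]
    exact hp.symm
  have hβ0 : aeval (⟨β, hβR⟩ : R) h = 0 := by
    apply Subtype.ext
    rw [← Subalgebra.coe_val, ← aeval_algHom_apply]
    exact minpoly.aeval A β
  refine ⟨R, π, D, ψ, ?_, ?_, hπ, hψD, fun t ht => hDR t (Finset.mem_insert_of_mem ht), ?_⟩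
  · refine IsFractionRing.of_field R N fun z => ⟨⟨d z • z, hdR z⟩, algebraMap A R (d z), ?_⟩
    have h1 : algebraMap A N (d z) ≠ 0 := by simpa using hd0 z
    rw [← IsScalarTower.algebraMap_apply]
    change z = (d z • z) / _
    rw [Algebra.smul_def]
    field_simp
  · exact isNoetherianRing_of_fg (by simpa using Subalgebra.fg_adjoin_finset {β})
  · intro x hx
    obtain ⟨p, rfl⟩ := hRp x
    rw [hψp, ← AlgHom.commutes ψ, hψA] at hx
    -- Expanding `h(β) = 0` around `b` gives `(h'(b) + kγ)γ = -h(b)`, divisible by `π`. The factor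
    -- `s = h'(b) + kγ` is nonzero at `ψ`, since `h'(β)` is.
    obtain ⟨k, hk⟩ := binomExpansion (h.map (algebraMap A R)) (algebraMap A R b)
      (⟨β, hβR⟩ - algebraMap A R b)
    simp only [add_sub_cancel, derivative_map, eval_map_algebraMap, hβ0,
      aeval_algebraMap_apply_eq_algebraMap_eval] at hk
    set γ : R := ⟨β, hβR⟩ - algebraMap A R b with hγ
    set s := algebraMap A R ((derivative h).eval b) + k * γ with hs
    have hγ0 : ψ γ = 0 := by rw [hγ, map_sub, hψβ, AlgHom.commutes, sub_self]
    have hsγ : algebraMap A R π ∣ s * γ := by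
      have : s * γ = - algebraMap A R (h.eval b) := by rw [hs]; linear_combination -hk
      rw [this, dvd_neg]
      exact _root_.map_dvd _ (Ideal.mem_span_singleton.1 hb)
    refine ⟨s, ?_, ?_⟩
    · rw [hs, map_add, map_mul, hγ0, mul_zero, add_zero, AlgHom.commutes, ← hψp]
      intro h0
      apply hψD
      have hr := hDR _ (Finset.mem_insert_self _ _)
      have : algebraMap A R D = ⟨_, hr⟩ * aeval (⟨β, hβR⟩ : R) (derivative h) := by
        apply Subtype.ext
        have h2 : ((aeval (⟨β, hβR⟩ : R) (derivative h) : R) : N) = aeval β (derivative h) := by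
          rw [← Subalgebra.coe_val, ← aeval_algHom_apply]
          rfl
        rw [MulMemClass.coe_mul, h2, Algebra.smul_mul_assoc, inv_mul_cancel₀ hder,
          Algebra.smul_def, mul_one]
        rfl
      rw [this, map_mul, h0, mul_zero]
    · obtain ⟨w, hw⟩ := sub_dvd_eval_sub (⟨β, hβR⟩ : R) (algebraMap A R b) (p.map (algebraMap A R))
      simp only [eval_map_algebraMap, aeval_algebraMap_apply_eq_algebraMap_eval] at hw
      rw [← hγ, sub_eq_iff_eq_add] at hw
      rw [hw, mul_add, ← mul_assoc]
      exact dvd_add (hsγ.mul_right _) ((_root_.map_dvd _ hx).mul_left _)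

/-- A finite separable extension `N` of the fraction field of `A` is the fraction field of a
discrete valuation ring, unramified of degree one over `A` and containing a given finite set. -/
theorem UnitsSeparated.exists_unramified_degree_one {A : Type*} [CommRing A] [IsDomain A]
    [IsPrincipalIdealRing A] (hA : UnitsSeparated A) (hAf : ¬ IsField A)
    (E₀ : Type*) [Field E₀] [Algebra A E₀] [IsFractionRing A E₀]
    (N : Type*) [Field N] [Algebra E₀ N] [Algebra A N] [IsScalarTower A E₀ N]
    [FiniteDimensional E₀ N] [Algebra.IsSeparable E₀ N] (T : Finset N) :
    ∃ (B : Subalgebra A N) (π : A), (∀ t ∈ T, t ∈ B) ∧ Prime (algebraMap A B π) ∧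
      (∀ y : N, y ^ 2 ∈ B → y ∈ B) ∧ ∀ b : B, ∃ c : A, algebraMap A B π ∣ algebraMap A B c - b := by
  obtain ⟨R, π, D, ψ, hRN, hRnoeth, hπ, hψD, hDT, hunr⟩ :=
    hA.exists_unramified_point hAf E₀ N T
  have hPm : (Ideal.span {π}).IsMaximal :=
    ((Ideal.span_singleton_prime hπ.ne_zero).2 hπ).isMaximal (by simpa using hπ.ne_zero)
  let _ : Field (A ⧸ Ideal.span {π}) := Ideal.Quotient.field _
  set q : Ideal R := RingHom.ker ψ with hq
  have hqp : q.IsPrime := RingHom.ker_isPrime _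
  set B := Localization.subalgebra.ofField N q.primeCompl q.primeCompl_le_nonZeroDivisors with hB
  have hloc : IsLocalization.AtPrime B q := Localization.subalgebra.isLocalization_ofField _ _ _
  have hBN : IsFractionRing B N := Localization.subalgebra.isFractionRing_ofField _ _ _
  have hBl : IsLocalRing B := IsLocalization.AtPrime.isLocalRing B q
  have hBnoeth : IsNoetherianRing B := IsLocalization.isNoetherianRing q.primeCompl B hRnoeth
  have hinj : Function.Injective (algebraMap A N) := by
    rw [IsScalarTower.algebraMap_eq A E₀ N]
    exact (algebraMap E₀ N).injective.comp (IsFractionRing.injective A E₀)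
  have hunit (s : R) (hs : ψ s ≠ 0) : IsUnit (algebraMap R B s) :=
    IsLocalization.map_units B (⟨s, hs⟩ : q.primeCompl)
  set ϖ : B := algebraMap R B (algebraMap A R π) with hϖ
  have hϖ0 : ϖ ≠ 0 := by
    intro h0
    have : ((ϖ : B) : N) = algebraMap A N π := rfl
    rw [h0] at this
    exact hπ.ne_zero (hinj (by simpa using this.symm))
  have hϖq : ψ (algebraMap A R π) = 0 := by
    rw [AlgHom.commutes]
    exact Ideal.Quotient.eq_zero_iff_mem.2 (Ideal.mem_span_singleton_self π)
  have hdvd (x : R) (hx : ψ x = 0) : ϖ ∣ algebraMap R B x := by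
    obtain ⟨s, hs, hsx⟩ := hunr x hx
    have := _root_.map_dvd (algebraMap R B) hsx
    rw [map_mul] at this
    exact ((hunit s hs).dvd_mul_left).1 this
  -- Unramifiedness makes `π` a uniformizer, so `B` is a discrete valuation ring.
  have hmax : IsLocalRing.maximalIdeal B = Ideal.span {ϖ} := by
    rw [← IsLocalization.AtPrime.map_eq_maximalIdeal q B]
    apply le_antisymm
    · rw [Ideal.map_le_iff_le_comap]
      exact fun x hx => Ideal.mem_span_singleton.2 (hdvd x hx)
    · rw [Ideal.span_singleton_le_iff_mem]
      exact Ideal.mem_map_of_mem _ hϖq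
  have hprin : IsPrincipalIdealRing B :=
    ((tfae_of_isNoetherianRing_of_isLocalRing_of_isDomain B).out 0 4 :
      IsPrincipalIdealRing B ↔ (IsLocalRing.maximalIdeal B).IsPrincipal).2 ⟨ϖ, hmax⟩
  have hprime : Prime ϖ := by
    rw [← Ideal.span_singleton_prime hϖ0, ← hmax]
    infer_instance
  refine ⟨B.restrictScalars A, π, fun t ht => ?_, hprime, fun y hy => ?_, fun (b : B) => ?_⟩
  · obtain ⟨u, hu⟩ := (hunit _ hψD).exists_left_inv
    have h1 : t = ((u * algebraMap R B ⟨_, hDT t ht⟩ : B) : N) := by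
      have h2 := congrArg (Subtype.val : B → N) hu
      change (u : N) * algebraMap A N D = 1 at h2
      change t = (u : N) * (D • t)
      rw [Algebra.smul_def, ← mul_assoc, h2, one_mul]
    rw [h1]
    exact (u * algebraMap R B ⟨_, hDT t ht⟩ : B).2
  · have hint : IsIntegral B (y ^ 2) := isIntegral_algebraMap (R := B) (x := ⟨y ^ 2, hy⟩)
    obtain ⟨z, hz⟩ := IsIntegrallyClosed.isIntegral_iff.1 (hint.of_pow two_pos)
    rw [← hz]
    exact z.2
  · obtain ⟨x, s, hxs⟩ := IsLocalization.exists_mk'_eq (S := B) q.primeCompl b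
    obtain ⟨c, hc⟩ := Ideal.Quotient.mk_surjective (ψ x / ψ s)
    refine ⟨c, ?_⟩
    have hs : ψ s ≠ 0 := s.2
    have h1 : ψ (s * algebraMap A R c - x) = 0 := by
      rw [map_sub, map_mul, AlgHom.commutes]
      change ψ s * Ideal.Quotient.mk _ c - _ = 0
      rw [hc]
      field_simp
      ring
    have h2 := hdvd _ h1
    have h3 : algebraMap R B s * (algebraMap R B (algebraMap A R c) - b)
        = algebraMap R B (s * algebraMap A R c - x) := by
      rw [← hxs, mul_sub, IsLocalization.mk'_spec', map_sub, map_mul]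
    rw [← h3] at h2
    exact ((hunit _ hs).dvd_mul_left).1 h2

/-- A polynomial over `N` with a simple root in `N` takes a nonsquare value at some element
of `A`. -/
theorem UnitsSeparated.exists_not_isSquare {A : Type*} [CommRing A] [IsDomain A]
    [IsPrincipalIdealRing A] (hA : UnitsSeparated A) (hAf : ¬ IsField A)
    (E₀ : Type*) [Field E₀] [Algebra A E₀] [IsFractionRing A E₀]
    (N : Type*) [Field N] [Algebra E₀ N] [Algebra A N] [IsScalarTower A E₀ N]
    [FiniteDimensional E₀ N] [Algebra.IsSeparable E₀ N] (r : N) (G : N[X]) (hG : G.eval r ≠ 0) :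
    ∃ c : A, ¬ IsSquare ((algebraMap A N c - r) * G.eval (algebraMap A N c)) := by
  classical
  -- With `G(r)⁻¹` and the coefficients of `G` in `B`, `G(r)` is a unit there.
  obtain ⟨B, π, hT, hπ, hsq, hres⟩ := hA.exists_unramified_degree_one hAf E₀ N
    ({r, (G.eval r)⁻¹} ∪ G.coeffs)
  have hr : r ∈ B := hT _ (by simp)
  have hGr : (G.eval r)⁻¹ ∈ B := hT _ (by simp)
  obtain ⟨G', rfl⟩ : ∃ G' : B[X], G = G'.map (algebraMap B N) := by
    have : G ∈ Polynomial.lifts (algebraMap B N) := by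
      rw [lifts_iff_coeff_lifts]
      intro n
      by_cases h0 : G.coeff n = 0
      · exact ⟨0, by simp [h0]⟩
      · exact ⟨⟨_, hT _ (Finset.mem_union_right _ (coeff_mem_coeffs h0))⟩, rfl⟩
    obtain ⟨G', hG'⟩ := (mem_lifts _).1 this
    exact ⟨G', hG'.symm⟩
  set ϖ := algebraMap A B π with hϖ
  set ρ : B := ⟨r, hr⟩ with hρ
  obtain ⟨c, u, hcu, hu⟩ : ∃ (c : A) (u : B), algebraMap A B c - ρ = ϖ * u ∧ ¬ ϖ ∣ u := by
    obtain ⟨c, u, hcu⟩ := hres ρ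
    -- If `c` approximates `r` to order two or more, `c + π` does so to order exactly one.
    by_cases hu : ϖ ∣ u
    · refine ⟨c + π, u + 1, ?_, fun h => hπ.not_dvd_one ((dvd_add_right hu).1 h)⟩
      rw [map_add, mul_add, ← hcu]
      ring
    · exact ⟨c, u, hcu, hu⟩
  have hGu : ¬ ϖ ∣ G'.eval (algebraMap A B c) := by
    intro h
    have h1 : ϖ ∣ G'.eval (algebraMap A B c) - G'.eval ρ :=
      (Dvd.intro _ hcu.symm).trans (sub_dvd_eval_sub _ _ _)
    have h2 : ϖ ∣ G'.eval ρ := (dvd_sub_right h).1 h1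
    have h3 : G'.eval ρ * ⟨_, hGr⟩ = 1 := by
      apply Subtype.ext
      have h4 : (G'.map (algebraMap B N)).eval r = ((G'.eval ρ : B) : N) := by
        change (G'.map (algebraMap B N)).eval (algebraMap B N ρ) = _
        rw [eval_map_apply]
        rfl
      rw [MulMemClass.coe_mul]
      simp only
      rw [← h4, mul_inv_cancel₀ hG]
      rfl
    exact hπ.not_dvd_one (h3 ▸ h2.mul_right _)
  refine ⟨c, ?_⟩
  rintro ⟨y, hy⟩
  have h1 : (algebraMap A N c - r) * (G'.map (algebraMap B N)).eval (algebraMap A N c)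
      = ((ϖ * u * G'.eval (algebraMap A B c) : B) : N) := by
    rw [← hcu, IsScalarTower.algebraMap_apply A B N, eval_map_apply]
    rfl
  rw [h1, ← pow_two] at hy
  have hyB : y ∈ B := hsq y (hy ▸ Subtype.property _)
  obtain ⟨y, rfl⟩ : ∃ y' : B, (y' : N) = y := ⟨⟨y, hyB⟩, rfl⟩
  have h2 : ϖ * u * G'.eval (algebraMap A B c) = y ^ 2 := Subtype.ext hy
  obtain ⟨z, rfl⟩ : ϖ ∣ y := hπ.dvd_of_dvd_pow (h2 ▸ (dvd_mul_right _ _).mul_right _)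
  have h3 : u * G'.eval (algebraMap A B c) = ϖ * z ^ 2 :=
    mul_left_cancel₀ hπ.ne_zero (by linear_combination h2)
  rcases hπ.dvd_or_dvd (Dvd.intro _ h3.symm) with h | h
  · exact hu h
  · exact hGu h

/-! ### Square roots, separability and conjugate embeddings -/

theorem two_ne_zero_iff_of_algebra (K L : Type*) [Field K] [Field L] [Algebra K L] :
    (2 : L) ≠ 0 ↔ (2 : K) ≠ 0 := by
  rw [← map_ofNat (algebraMap K L) 2, _root_.map_ne_zero]

theorem isSeparable_of_sq_eq_algebraMap {K L : Type*} [Field K] [Field L] [Algebra K L]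
    (h2 : (2 : K) ≠ 0) {w : L} {a : K} (hw : w ^ 2 = algebraMap K L a) : IsSeparable K w := by
  by_cases ha : a = 0
  · obtain rfl : w = 0 := by simpa [ha] using hw
    simpa using isSeparable_algebraMap (K := L) (0 : K)
  · have h1 : (X ^ 2 - C a : K[X]).Separable := separable_X_pow_sub_C a (by simpa using h2) ha
    exact h1.of_dvd (minpoly.dvd K w (by simp [hw]))

/-- Away from characteristic `2` a square root is separable, so if it lay outside `M` it would have
another conjugate over `M`. -/
theorem IntermediateField.mem_of_sq_mem_of_forall_algEquiv {E Ω : Type*} [Field E] [Field Ω]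
    [Algebra E Ω] [Normal E Ω] (h2 : (2 : E) ≠ 0) (M : IntermediateField E Ω) {w : Ω}
    (hw : w ^ 2 ∈ M) (h : ∀ τ : Ω ≃ₐ[M] Ω, τ w = w) : w ∈ M := by
  have h2' : (2 : M) ≠ 0 := (two_ne_zero_iff_of_algebra E M).2 h2
  have : Normal M Ω := Normal.tower_top_of_normal E M Ω
  by_contra hM
  have hbot : w ∉ (⊥ : Subalgebra M Ω) := by
    rintro ⟨x, hx⟩
    exact hM (hx ▸ x.2)
  obtain ⟨y, hy, hconj⟩ := (notMem_iff_exists_ne_and_isConjRoot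
    (isSeparable_of_sq_eq_algebraMap h2' (a := (⟨_, hw⟩ : M)) rfl) (Normal.splits ‹_› w)).1 hbot
  obtain ⟨τ, hτ⟩ := hconj.symm.exists_algEquiv
  exact hy (by rw [← hτ, h τ])

theorem mem_separableClosure_of_sq_mem {K L : Type*} [Field K] [Field L] [Algebra K L]
    (h2 : (2 : K) ≠ 0) {w : L} (hw : w ^ 2 ∈ separableClosure K L) : w ∈ separableClosure K L := by
  have h2' : (2 : separableClosure K L) ≠ 0 :=
    (two_ne_zero_iff_of_algebra K _).2 h2
  rw [mem_separableClosure_iff]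
  have : IsSeparable (separableClosure K L) w :=
    isSeparable_of_sq_eq_algebraMap h2' (a := ⟨w ^ 2, hw⟩) rfl
  exact IsSeparable.of_algebra_isSeparable_of_isSeparable K this

/-- Let `k` be stable under the automorphisms of `Ω` and let `F` be a finite extension of `k`.
An automorphism of `Ω` fixing the images of suitable finitely many elements of `F` under two
embeddings `φ₁` and `φ₂` fixes `φ₁ y * φ₂ y` for all `y` such that it fixes `φ₁ (y ^ 2)`. -/
theorem IntermediateField.exists_finset_forall_algEquiv_mul_eq {E Ω : Type*} [Field E] [Field Ω]
    [Algebra E Ω] (k : IntermediateField E Ω) (hk : ∀ τ : Ω ≃ₐ[E] Ω, ∀ x ∈ k, τ x ∈ k)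
    (F : Type*) [Field F] [Algebra k F] [FiniteDimensional k F] :
    ∃ T : Finset F, ∀ (φ₁ φ₂ : F →ₐ[k] Ω) (τ : Ω ≃ₐ[E] Ω),
      (∀ t ∈ T, τ (φ₁ t) = φ₁ t ∧ τ (φ₂ t) = φ₂ t) →
      ∀ y, τ (φ₁ (y ^ 2)) = φ₁ (y ^ 2) → τ (φ₁ y * φ₂ y) = φ₁ y * φ₂ y := by
  obtain ⟨T, hT⟩ := (Module.Finite.fg_top : (⊤ : Submodule k F).FG)
  refine ⟨T, fun φ₁ φ₂ τ h y hy => ?_⟩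
  -- Both embeddings are linear over `k` and `τ` preserves `k`, so applying `τ` to the coefficients
  -- of `y` over `T` gives one `y'` that serves both. Below, `y' = ±y` and the sign cancels in the
  -- product.
  have key (y : F) : ∃ y', τ (φ₁ y) = φ₁ y' ∧ τ (φ₂ y) = φ₂ y' := by
    have hy : y ∈ Submodule.span k (T : Set F) := hT ▸ Submodule.mem_top
    induction hy using Submodule.span_induction with
    | mem t ht => exact ⟨t, h t ht⟩
    | zero => exact ⟨0, by simp⟩
    | add a b _ _ ha hb =>
      obtain ⟨a', ha₁, ha₂⟩ := ha
      obtain ⟨b', hb₁, hb₂⟩ := hb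
      exact ⟨a' + b', by simp [ha₁, hb₁], by simp [ha₂, hb₂]⟩
    | smul x a _ ha =>
      obtain ⟨a', ha₁, ha₂⟩ := ha
      have hx (φ : F →ₐ[k] Ω) : φ (algebraMap k F ⟨τ x, hk τ x x.2⟩) = τ (φ (algebraMap k F x)) := by
        simp only [AlgHom.commutes]
        rfl
      refine ⟨algebraMap k F ⟨τ x, hk τ x x.2⟩ * a', ?_, ?_⟩
      · rw [map_mul, hx, Algebra.smul_def, map_mul, map_mul, ha₁]
      · rw [map_mul, hx, Algebra.smul_def, map_mul, map_mul, ha₂]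
  obtain ⟨y', h₁, h₂⟩ := key y
  have hsq : y' ^ 2 = y ^ 2 := by
    apply φ₁.injective
    change φ₁ (y' ^ 2) = φ₁ (y ^ 2)
    rw [← hy, map_pow, ← h₁, map_pow, map_pow]
  rw [map_mul, h₁, h₂]
  rcases sq_eq_sq_iff_eq_or_eq_neg.1 hsq with rfl | rfl <;> simp

/-- A high power of the exponential characteristic makes both images of `α` separable; injectivity
of Frobenius keeps them distinct. -/
theorem exists_algHom_ne_of_not_isPurelyInseparable {E₀ E Ω : Type*} [Field E₀] [Field E]
    [Field Ω] [Algebra E₀ E] [Algebra E Ω] [Algebra E₀ Ω] [Algebra.IsAlgebraic E₀ Ω]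
    [IsAlgClosed Ω] (k : IntermediateField E Ω)
    (F : Type*) [Field F] [Algebra k F] [FiniteDimensional k F] (hF : ¬ IsPurelyInseparable k F) :
    ∃ (φ₁ φ₂ : F →ₐ[k] Ω) (α : F), φ₁ α ≠ φ₂ α ∧ φ₁ α ∈ separableClosure E₀ Ω ∧
      φ₂ α ∈ separableClosure E₀ Ω := by
  rw [isPurelyInseparable_iff_subsingleton_emb,
    (Field.embEquivOfIsAlgClosed k F Ω).subsingleton_congr, not_subsingleton_iff_nontrivial] at hF
  obtain ⟨φ₁, φ₂, hne⟩ := hF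
  obtain ⟨α, hα⟩ := DFunLike.ne_iff.1 hne
  obtain ⟨q, hq⟩ := ExpChar.exists Ω
  have : ExpChar (separableClosure E₀ Ω) q :=
    (RingHom.expChar_iff (algebraMap (separableClosure E₀ Ω) Ω)
      (algebraMap (separableClosure E₀ Ω) Ω).injective q).2 hq
  have hpow (x : Ω) : ∃ n, x ^ q ^ n ∈ separableClosure E₀ Ω := by
    obtain ⟨n, y, hy⟩ := IsPurelyInseparable.pow_mem (separableClosure E₀ Ω) q x
    exact ⟨n, hy ▸ y.2⟩
  obtain ⟨m, hm⟩ := hpow (φ₁ α)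
  obtain ⟨n, hn⟩ := hpow (φ₂ α)
  refine ⟨φ₁, φ₂, α ^ q ^ (m + n), ?_, ?_, ?_⟩
  · rw [map_pow, map_pow]
    exact fun h => hα (iterateFrobenius_inj Ω q (m + n) h)
  · rw [map_pow, pow_add, pow_mul]
    exact pow_mem hm _
  · rw [map_pow, add_comm, pow_add, pow_mul]
    exact pow_mem hn _

/-! ### The criterion for hereditarily non-pythagorean fields -/

/-- Let `E` be a finite extension of the fraction field `E₀` of `A`. Every subfield of an algebraic
closure of `E` that is stable under the automorphisms over `E` is hereditarily non-pythagorean. -/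
theorem UnitsSeparated.isHereditarilyNonPythagorean {A : Type*} [CommRing A] [IsDomain A]
    [IsPrincipalIdealRing A] (hA : UnitsSeparated A) (hAf : ¬ IsField A)
    (E₀ : Type*) [Field E₀] [Algebra A E₀] [IsFractionRing A E₀]
    {E : Type*} [Field E] [Algebra E₀ E] [FiniteDimensional E₀ E]
    {Ω : Type v} [Field Ω] [Algebra E Ω] [IsAlgClosure E Ω] (h2 : (2 : E) ≠ 0)
    (k : IntermediateField E Ω) (hk : ∀ τ : Ω ≃ₐ[E] Ω, ∀ x ∈ k, τ x ∈ k) :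
    IsHereditarilyNonPythagorean k := by
  classical
  intro F _ _ _ _ hF hpyth
  let _ : Algebra E₀ Ω := ((algebraMap E Ω).comp (algebraMap E₀ E)).toAlgebra
  have : IsScalarTower E₀ E Ω := .of_algebraMap_eq fun _ => rfl
  have := IsAlgClosure.isAlgClosed E (K := Ω)
  have : Algebra.IsAlgebraic E Ω := IsAlgClosure.isAlgebraic
  have : Algebra.IsAlgebraic E₀ Ω := Algebra.IsAlgebraic.trans E₀ E Ω
  have : Normal E Ω := IsAlgClosure.normal E Ω
  have h2' : (2 : E₀) ≠ 0 := (two_ne_zero_iff_of_algebra E₀ E).1 h2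
  have h2Ω : (2 : Ω) ≠ 0 := (two_ne_zero_iff_of_algebra E Ω).2 h2
  obtain ⟨φ₁, φ₂, α, hne, hα₁, hα₂⟩ := exists_algHom_ne_of_not_isPurelyInseparable (E₀ := E₀) k F hF
  obtain ⟨T, hT⟩ := k.exists_finset_forall_algEquiv_mul_eq hk F
  -- This sign of `i` separates the root `-φ₁ α + i` from `-φ₂ α - i`; both signs cannot fail, as
  -- `4i ≠ 0`.
  obtain ⟨i, hi, hiα⟩ : ∃ i : Ω, i ^ 2 = -1 ∧ φ₂ α - φ₁ α + 2 * i ≠ 0 := by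
    obtain ⟨i, hi⟩ := IsAlgClosed.exists_pow_nat_eq (-1 : Ω) two_pos
    by_cases h : φ₂ α - φ₁ α + 2 * i = 0
    · refine ⟨-i, by simpa using hi, fun h' => ?_⟩
      have h0 : 2 * (2 * i) = 0 := by linear_combination h - h'
      have : i = 0 := by simpa [h2Ω] using h0
      simp [this] at hi
    · exact ⟨i, hi, h⟩
  have hi0 : i ≠ 0 := by
    rintro rfl
    simp at hi
  have hiS : i ∈ separableClosure E₀ Ω :=
    mem_separableClosure_of_sq_mem h2' (hi ▸ neg_mem (one_mem _))
  set T' : Finset Ω := {i, φ₁ α, φ₂ α} ∪ (T.image φ₁ ∪ T.image φ₂) with hT'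
  set M : IntermediateField E Ω := IntermediateField.adjoin E (T' : Set Ω) with hM
  have hMT {x : Ω} (hx : x ∈ T') : x ∈ M := IntermediateField.subset_adjoin _ _ hx
  have : FiniteDimensional E M :=
    IntermediateField.finiteDimensional_adjoin fun x _ => Algebra.IsIntegral.isIntegral x
  have : FiniteDimensional E₀ M := FiniteDimensional.trans E₀ E M
  -- `M` may be inseparable over `E₀`; its separable part still contains `i` and both images of `α`.
  set N : IntermediateField E₀ Ω := M.restrictScalars E₀ ⊓ separableClosure E₀ Ω with hN
  have : FiniteDimensional E₀ (M.restrictScalars E₀) := ‹FiniteDimensional E₀ M›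
  have : FiniteDimensional E₀ N := FiniteDimensional.of_injective
    (IntermediateField.inclusion (inf_le_left : N ≤ M.restrictScalars E₀)).toLinearMap
    (IntermediateField.inclusion (inf_le_left : N ≤ M.restrictScalars E₀)).injective
  have : Algebra.IsSeparable E₀ N := (le_separableClosure_iff E₀ Ω N).1 inf_le_right
  let _ : Algebra A N := ((algebraMap E₀ N).comp (algebraMap A E₀)).toAlgebra
  have : IsScalarTower A E₀ N := .of_algebraMap_eq fun _ => rfl
  set j : N := ⟨i, hMT (by simp [hT']), hiS⟩ with hj
  set a₁ : N := ⟨φ₁ α, hMT (by simp [hT']), hα₁⟩ with ha₁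
  set a₂ : N := ⟨φ₂ α, hMT (by simp [hT']), hα₂⟩ with ha₂
  have hj2 : j ^ 2 = -1 := Subtype.ext hi
  obtain ⟨c, hc⟩ := hA.exists_not_isSquare hAf E₀ N (-a₁ + j)
    ((X - C (-a₁ - j)) * (X - C (-a₂ + j)) * (X - C (-a₂ - j))) (by
      simp only [eval_mul, eval_sub, eval_X, eval_C]
      refine mul_ne_zero (mul_ne_zero ?_ ?_) ?_ <;> intro h <;>
        replace h := congrArg (algebraMap N Ω) h
      · have h0 : 2 * i = 0 := by
          rw [map_zero] at h
          rw [← h, map_sub, map_add, map_sub, map_neg]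
          change _ = -φ₁ α + i - (-φ₁ α - i)
          ring
        simp [h2Ω, hi0] at h0
      · apply hne
        have h0 : -φ₁ α + i - (-φ₂ α + i) = 0 := by simpa using h
        linear_combination -h0
      · apply hiα
        have h0 : -φ₁ α + i - (-φ₂ α - i) = 0 := by simpa using h
        linear_combination h0)
  set c' : N := algebraMap A N c with hc'
  have hval : (c' - (-a₁ + j)) * ((X - C (-a₁ - j)) * (X - C (-a₂ + j)) * (X - C (-a₂ - j))).eval c'
      = (1 + (a₁ + c') ^ 2) * (1 + (a₂ + c') ^ 2) := by
    simp only [eval_mul, eval_sub, eval_X, eval_C]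
    linear_combination (-(a₁ + c') ^ 2 - (a₂ + c') ^ 2 + j ^ 2 - 1) * hj2
  rw [hval] at hc
  set cE : E := algebraMap E₀ E (algebraMap A E₀ c) with hcE
  set cF : F := algebraMap k F (algebraMap E k cE) with hcF
  have hφc (φ : F →ₐ[k] Ω) : φ cF = (c' : Ω) := by
    rw [hcF, AlgHom.commutes]
    rfl
  obtain ⟨y, hy⟩ := hpyth (1 + (α + cF) ^ 2)
    (IsSquare.isSumSq IsSquare.one |>.add (IsSquare.sq _).isSumSq)
  rw [← pow_two] at hy
  have hφy (φ : F →ₐ[k] Ω) : φ y ^ 2 = 1 + (φ α + c') ^ 2 := by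
    rw [← map_pow, ← hy]
    simp [hφc]
  have hw2 : (φ₁ y * φ₂ y) ^ 2 = (((1 + (a₁ + c') ^ 2) * (1 + (a₂ + c') ^ 2) : N) : Ω) := by
    rw [mul_pow, hφy, hφy]
    rfl
  have hwM : φ₁ y * φ₂ y ∈ M := by
    refine M.mem_of_sq_mem_of_forall_algEquiv h2 (hw2 ▸ (Subtype.property _ : _ ∈ N).1) fun τ => ?_
    have hτ (x : Ω) (hx : x ∈ M) : τ x = x := τ.commutes ⟨x, hx⟩
    refine hT φ₁ φ₂ (τ.restrictScalars E) (fun t ht => ⟨hτ _ (hMT ?_), hτ _ (hMT ?_)⟩) y (hτ _ ?_)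
    · simp only [hT', Finset.mem_union, Finset.mem_image]
      exact .inr (.inl ⟨t, ht, rfl⟩)
    · simp only [hT', Finset.mem_union, Finset.mem_image]
      exact .inr (.inr ⟨t, ht, rfl⟩)
    · rw [map_pow, hφy]
      exact (Subtype.property (1 + (a₁ + c') ^ 2 : N)).1
  have hwN : φ₁ y * φ₂ y ∈ N :=
    ⟨hwM, mem_separableClosure_of_sq_mem h2' (hw2 ▸ (Subtype.property _ : _ ∈ N).2)⟩
  exact hc ⟨⟨_, hwN⟩, Subtype.ext (by rw [← hw2, pow_two]; rfl)⟩

/-! ### Finitely generated fields -/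

theorem IntermediateField.fg_top_of_field_fg (K : Type*) {E : Type*} [Field K] [Field E]
    [Algebra K E] (h : Field.FG E) : (⊤ : IntermediateField K E).FG := by
  obtain ⟨S, hS⟩ := h.finitely_generated
  refine ⟨S, ?_⟩
  rw [← IntermediateField.toSubfield_inj, IntermediateField.adjoin_toSubfield,
    Subfield.closure_union, hS]
  simp

theorem finiteDimensional_of_field_fg (K : Type*) {E : Type*} [Field K] [Field E] [Algebra K E]
    [Algebra.IsAlgebraic K E] (h : Field.FG E) : FiniteDimensional K E := by
  obtain ⟨S, hS⟩ := IntermediateField.fg_top_of_field_fg K h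
  have : FiniteDimensional K (IntermediateField.adjoin K (S : Set E)) :=
    IntermediateField.finiteDimensional_adjoin fun x _ => Algebra.IsIntegral.isIntegral x
  rw [hS] at this
  exact IntermediateField.topEquiv.toLinearEquiv.finiteDimensional

/-- All elements but one of a transcendence basis go into `K`; the remaining one is `t`. -/
theorem exists_transcendental_isAlgebraic_adjoin_simple (K₀ E : Type*) [Field K₀] [Field E]
    [Algebra K₀ E] (h : ¬ Algebra.IsAlgebraic K₀ E) :
    ∃ (K : IntermediateField K₀ E) (t : E), Transcendental K t ∧ Algebra.IsAlgebraic K⟮t⟯ E := by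
  obtain ⟨s, hs⟩ := exists_isTranscendenceBasis K₀ E
  obtain ⟨t⟩ : Nonempty s := by
    by_contra hne
    exact h (hs.isEmpty_iff_isAlgebraic.1 (not_nonempty_iff.1 hne))
  refine ⟨IntermediateField.adjoin K₀ (Subtype.val '' ({t}ᶜ : Set s)), t, ?_, ?_⟩
  · rw [IntermediateField.transcendental_adjoin_iff]
    exact ((AlgebraicIndependent.iff_transcendental_adjoin_image t).1 hs.1).2
  · have h1 := hs.isAlgebraic_field
    set K := IntermediateField.adjoin K₀ (Subtype.val '' ({t}ᶜ : Set s)) with hK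
    have h2 : IntermediateField.adjoin K₀ (Set.range (Subtype.val : s → E)) ≤
        K⟮(t : E)⟯.restrictScalars K₀ := by
      rw [IntermediateField.adjoin_le_iff]
      rintro _ ⟨x, rfl⟩
      by_cases hx : x = t
      · subst hx
        exact IntermediateField.mem_adjoin_simple_self K _
      · exact K⟮(t : E)⟯.algebraMap_mem
          ⟨x, IntermediateField.subset_adjoin _ _ ⟨x, hx, rfl⟩⟩
    let ι : IntermediateField.adjoin K₀ (Set.range (Subtype.val : s → E)) →+* K⟮(t : E)⟯ :=
      (IntermediateField.inclusion h2).toRingHom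
    refine ⟨fun x => ?_⟩
    obtain ⟨p, hp, hpx⟩ := h1.isAlgebraic x
    refine ⟨p.map ι, (Polynomial.map_ne_zero_iff ι.injective).2 hp, ?_⟩
    rw [aeval_def, eval₂_map]
    exact hpx

/-- An infinite finitely generated field of characteristic not two: subfields of its algebraic
closure that are stable under automorphisms are hereditarily non-pythagorean. -/
theorem isHereditarilyNonPythagorean_of_field_fg {E : Type u} [Field E] [Infinite E]
    (hfg : Field.FG E) (h2 : (2 : E) ≠ 0) {Ω : Type v} [Field Ω] [Algebra E Ω] [IsAlgClosure E Ω]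
    (k : IntermediateField E Ω) (hk : ∀ τ : Ω ≃ₐ[E] Ω, ∀ x ∈ k, τ x ∈ k) :
    IsHereditarilyNonPythagorean k := by
  -- Here `A = K[X]` with `X ↦ t`. For the prime field as `K₀`, the algebraic case arises only over
  -- `ℚ`, where `A = ℤ`; over `𝔽_p` it would make `E` finite.
  have key (K₀ : Type) [Field K₀] [Algebra K₀ E] (h : ¬ Algebra.IsAlgebraic K₀ E) :
      IsHereditarilyNonPythagorean k := by
    obtain ⟨K, t, ht, halg⟩ := exists_transcendental_isAlgebraic_adjoin_simple K₀ E h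
    have : FiniteDimensional K⟮t⟯ E := finiteDimensional_of_field_fg _ hfg
    let _ : Algebra K[X] K⟮t⟯ := (aeval (IntermediateField.AdjoinSimple.gen K t)).toAlgebra
    have hval (p : K[X]) : ((algebraMap K[X] K⟮t⟯ p : K⟮t⟯) : E) = aeval t p := by
      change K⟮t⟯.val (aeval (IntermediateField.AdjoinSimple.gen K t) p) = _
      rw [← aeval_algHom_apply]
      rfl
    have : FaithfulSMul K[X] K⟮t⟯ := by
      rw [faithfulSMul_iff_algebraMap_injective]
      intro p q hpq
      apply transcendental_iff_injective.1 ht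
      rw [← hval, ← hval, hpq]
    have : IsFractionRing K[X] K⟮t⟯ := by
      refine IsFractionRing.of_field _ _ fun z => ?_
      obtain ⟨r, s, hrs⟩ := (IntermediateField.mem_adjoin_simple_iff K (z : E)).1 z.2
      refine ⟨r, s, Subtype.ext ?_⟩
      rw [hrs, ← hval, ← hval]
      rfl
    exact (UnitsSeparated.polynomial K).isHereditarilyNonPythagorean (Polynomial.not_isField K)
      K⟮t⟯ h2 k hk
  obtain ⟨p, hp⟩ := CharP.exists E
  rcases CharP.char_is_prime_or_zero E p with hprime | rfl
  · have := Fact.mk hprime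
    let _ : Algebra (ZMod p) E := ZMod.algebra E p
    refine key (ZMod p) fun halg => ?_
    have : FiniteDimensional (ZMod p) E := finiteDimensional_of_field_fg _ hfg
    exact not_finite_iff_infinite.2 ‹_› (Module.finite_of_finite (ZMod p))
  · have := CharP.charP_to_charZero E
    by_cases halg : Algebra.IsAlgebraic ℚ E
    · have : FiniteDimensional ℚ E := finiteDimensional_of_field_fg _ hfg
      exact UnitsSeparated.int.isHereditarilyNonPythagorean Int.not_isField ℚ h2 k hk
    · exact key ℚ halg

theorem ContainsGlobalField.infinite {E : Type u} [Field E] (h : ContainsGlobalField E) :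
    Infinite E := by
  obtain ⟨K, hK | ⟨k, _, _, _, _⟩⟩ := h
  · have := hK.to_charZero
    exact Infinite.of_injective ((↑) : K → E) Subtype.val_injective
  · have h1 : Infinite (RatFunc k) :=
      Infinite.of_injective _ (IsFractionRing.injective k[X] (RatFunc k))
    have h2 : Infinite K := Infinite.of_injective _ (algebraMap (RatFunc k) K).injective
    exact Infinite.of_injective ((↑) : K → E) Subtype.val_injective

theorem containsGlobalField_of_field_fg {E : Type u} [Field E] [Infinite E] (hfg : Field.FG E) :
    ContainsGlobalField E := by
  obtain ⟨p, hp⟩ := CharP.exists E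
  rcases CharP.char_is_prime_or_zero E p with hprime | rfl
  · have := Fact.mk hprime
    let _ : Algebra (ZMod p) E := ZMod.algebra E p
    have halg : ¬ Algebra.IsAlgebraic (ZMod p) E := fun halg => by
      have : FiniteDimensional (ZMod p) E := finiteDimensional_of_field_fg _ hfg
      exact not_finite_iff_infinite.2 ‹_› (Module.finite_of_finite (ZMod p))
    obtain ⟨t, ht⟩ : ∃ t : E, Transcendental (ZMod p) t := by
      by_contra! H
      exact halg ⟨fun x => not_not.1 (H x)⟩
    let f : RatFunc (ZMod p) →+* E :=
      IsFractionRing.lift (g := (aeval t : (ZMod p)[X] →ₐ[ZMod p] E).toRingHom)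
        (transcendental_iff_injective.1 ht)
    let _ : Algebra (RatFunc (ZMod p)) f.fieldRange := f.rangeRestrictField.toAlgebra
    refine ⟨f.fieldRange, .inr ⟨ZMod p, inferInstance, inferInstance, inferInstance, ?_⟩⟩
    exact Module.Finite.of_surjective (Algebra.linearMap (RatFunc (ZMod p)) f.fieldRange)
      f.rangeRestrictField_bijective.2
  · have := CharP.charP_to_charZero E
    let f : ℚ →+* E := algebraMap ℚ E
    have hf := f.rangeRestrictField_bijective
    have : CharZero f.fieldRange := charZero_of_injective_ringHom hf.1
    have : FiniteDimensional ℚ f.fieldRange := by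
      refine Module.Finite.of_surjective (Algebra.linearMap ℚ f.fieldRange) fun x => ?_
      obtain ⟨q, hq⟩ := hf.2 x
      exact ⟨q, hq ▸ (eq_ratCast (algebraMap ℚ _) q).trans (eq_ratCast f.rangeRestrictField q).symm⟩
    exact ⟨f.fieldRange, .inl {}⟩

/-! ### Algebraic extensions of finite fields -/

/-- A quadratically closed algebraic extension of a finite field is hereditarily quadratically
closed. -/
theorem IsQuadraticallyClosed.isHereditarilyQuadraticallyClosed (E : Type*) {k : Type v} [Field E]
    [Finite E] [Field k] [Algebra E k] [Algebra.IsAlgebraic E k] (hk : IsQuadraticallyClosed k) :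
    IsHereditarilyQuadraticallyClosed k := by
  intro F _ _ _ z
  -- All roots of unity of `2`-power order in `F` already lie in `k`: inductively `ζ²` does, and its
  -- square root in `k` is `±ζ`.
  have hroot (a : ℕ) : ∀ ζ : F, ζ ^ 2 ^ a = 1 → ζ ∈ (algebraMap k F).range := by
    induction a with
    | zero => exact fun ζ hζ => ⟨1, by simpa using hζ.symm⟩
    | succ a ih =>
      intro ζ hζ
      obtain ⟨w, hw⟩ := ih (ζ ^ 2) (by rw [← pow_mul, ← pow_succ', hζ])
      obtain ⟨v, rfl⟩ := hk w
      rw [← pow_two, map_pow, sq_eq_sq_iff_eq_or_eq_neg] at hw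
      rcases hw with h | h
      · exact ⟨v, h⟩
      · exact ⟨-v, by rw [map_neg, h, neg_neg]⟩
  by_cases hz : z = 0
  · exact hz ▸ IsSquare.zero
  let _ : Algebra E F := ((algebraMap k F).comp (algebraMap E k)).toAlgebra
  have : IsScalarTower E k F := .of_algebraMap_eq fun _ => rfl
  have : Algebra.IsAlgebraic E F := Algebra.IsAlgebraic.trans E k F
  have : FiniteDimensional E E⟮z⟯ :=
    IntermediateField.adjoin.finiteDimensional (Algebra.IsIntegral.isIntegral z)
  have : Finite E⟮z⟯ := Module.finite_of_finite E
  have hfin : IsOfFinOrder z := by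
    have h1 : IsOfFinOrder (Units.mk0 (IntermediateField.AdjoinSimple.gen E z) fun h =>
      hz (congrArg Subtype.val h)) := isOfFinOrder_of_finite _
    obtain ⟨n, hn, h⟩ := isOfFinOrder_iff_pow_eq_one.1 h1
    refine isOfFinOrder_iff_pow_eq_one.2 ⟨n, hn, ?_⟩
    exact congrArg (fun x : E⟮z⟯ˣ => ((x : E⟮z⟯) : F)) h
  -- For `z` of order `2^a (2l + 1)`, `z^(2l+1)` lies in `k`, hence is a square, and `z = z^(2l+1) /
  -- (z^l)²`.
  obtain ⟨a, m, ⟨l, rfl⟩, hm⟩ := Nat.exists_eq_two_pow_mul_odd hfin.orderOf_pos.ne'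
  obtain ⟨w, hw⟩ := hroot a (z ^ (2 * l + 1)) (by
    rw [← pow_mul, mul_comm, ← hm, pow_orderOf_eq_one])
  obtain ⟨v, rfl⟩ := hk w
  refine ⟨algebraMap k F v / z ^ l, ?_⟩
  rw [div_mul_div_comm, ← map_mul, hw, pow_succ, two_mul, pow_add]
  field_simp

theorem FiniteField.exists_sq_add_sq {K : Type*} [Field K] [Finite K] (h2 : (2 : K) ≠ 0) (x : K) :
    ∃ a b : K, x = a ^ 2 + b ^ 2 := by
  have := Fintype.ofFinite K
  have hc : ringChar K ≠ 2 := fun h => h2 (by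
    have := ringChar.Nat.cast_ringChar (R := K)
    rw [h] at this
    simpa using this)
  obtain ⟨a, b, hab⟩ := FiniteField.exists_root_sum_quadratic (f := (X ^ 2 : K[X]))
    (g := X ^ 2 - C x) (degree_X_pow 2) (degree_X_pow_sub_C two_pos x)
    (FiniteField.odd_card_of_char_ne_two hc)
  refine ⟨a, b, ?_⟩
  simp only [eval_pow, eval_X, eval_sub, eval_C] at hab
  linear_combination -hab

/-! ### Stability of the closures under automorphisms, and finite `E` -/

section Closures

variable {E : Type u} [Field E] {Ω : Type v} [Field Ω] [Algebra E Ω]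

theorem IsPythagoreanTower.map {K : IntermediateField E Ω} (hK : IsPythagoreanTower E Ω K)
    (τ : Ω →ₐ[E] Ω) : IsPythagoreanTower E Ω (K.map τ) := by
  induction hK with
  | base => rw [IntermediateField.map_bot]; exact .base
  | step K a b x _ ha hb hx ih =>
    rw [IntermediateField.map_sup, IntermediateField.adjoin_map, Set.image_singleton]
    exact .step _ (τ a) (τ b) (τ x) ih ⟨a, ha, rfl⟩ ⟨b, hb, rfl⟩ (by simp [← map_pow, hx])

theorem IsQuadraticTower.map {K : IntermediateField E Ω} (hK : IsQuadraticTower E Ω K)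
    (τ : Ω →ₐ[E] Ω) : IsQuadraticTower E Ω (K.map τ) := by
  induction hK with
  | base => rw [IntermediateField.map_bot]; exact .base
  | step K a x _ ha hx ih =>
    rw [IntermediateField.map_sup, IntermediateField.adjoin_map, Set.image_singleton]
    exact .step _ (τ a) (τ x) ih ⟨a, ha, rfl⟩ (by simp [← map_pow, hx])

theorem map_mem_pythagoreanClosure (τ : Ω →ₐ[E] Ω) {x : Ω} (hx : x ∈ pythagoreanClosure E Ω) :
    τ x ∈ pythagoreanClosure E Ω := by
  rw [mem_pythagoreanClosure_iff] at hx ⊢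
  obtain ⟨K, hK, hx⟩ := hx
  exact ⟨_, hK.map τ, x, hx, rfl⟩

theorem map_mem_quadraticClosure (τ : Ω →ₐ[E] Ω) {x : Ω} (hx : x ∈ quadraticClosure E Ω) :
    τ x ∈ quadraticClosure E Ω := by
  rw [mem_quadraticClosure_iff] at hx ⊢
  obtain ⟨K, hK, hx⟩ := hx
  exact ⟨_, hK.map τ, x, hx, rfl⟩

/-- Each `a` is a sum of two squares in the finite field `E⟮a⟯`, so adjoining its square root is a
legitimate tower step. -/
theorem isQuadraticallyClosed_pythagoreanClosure [Finite E] [IsAlgClosure E Ω]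
    (h2 : (2 : E) ≠ 0) : IsQuadraticallyClosed (pythagoreanClosure E Ω) := by
  rintro ⟨a, ha⟩
  have := IsAlgClosure.isAlgClosed E (K := Ω)
  have : Algebra.IsAlgebraic E Ω := IsAlgClosure.isAlgebraic
  obtain ⟨K, hK, haK⟩ := mem_pythagoreanClosure_iff.1 ha
  have hle : E⟮a⟯ ≤ K := IntermediateField.adjoin_simple_le_iff.2 haK
  have : FiniteDimensional E E⟮a⟯ :=
    IntermediateField.adjoin.finiteDimensional (Algebra.IsIntegral.isIntegral a)
  have : Finite E⟮a⟯ := Module.finite_of_finite E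
  obtain ⟨b, c, hbc⟩ := FiniteField.exists_sq_add_sq ((two_ne_zero_iff_of_algebra E E⟮a⟯).2 h2)
    (IntermediateField.AdjoinSimple.gen E a)
  have hbc' : a = (b : Ω) ^ 2 + (c : Ω) ^ 2 := congrArg Subtype.val hbc
  obtain ⟨x, hx⟩ := IsAlgClosed.exists_pow_nat_eq a two_pos
  have hxk : x ∈ pythagoreanClosure E Ω := mem_pythagoreanClosure_iff.2
    ⟨_, .step K b c x hK (hle b.2) (hle c.2) (hx.trans hbc'),
      (le_sup_right : E⟮x⟯ ≤ K ⊔ E⟮x⟯) (IntermediateField.mem_adjoin_simple_self E x)⟩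
  exact ⟨⟨x, hxk⟩, Subtype.ext (hx.symm.trans (pow_two x))⟩

end Closures

theorem mainTheorem5 (E : Type u) [Field E] (Ω : Type v) [Field Ω] [Algebra E Ω]
    [IsAlgClosure E Ω] (hchar : ringChar E ≠ 2) (hfg : Field.FG E) :
    (ContainsGlobalField E →
      IsHereditarilyNonPythagorean (pythagoreanClosure E Ω) ∧
      IsHereditarilyNonPythagorean (quadraticClosure E Ω)) ∧
    (¬ ContainsGlobalField E →
      Finite E ∧ IsHereditarilyQuadraticallyClosed (pythagoreanClosure E Ω)) := by
  have h2 : (2 : E) ≠ 0 := Ring.two_ne_zero hchar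
  refine ⟨fun h => ?_, fun h => ?_⟩
  · have := h.infinite
    exact ⟨isHereditarilyNonPythagorean_of_field_fg hfg h2 _
        fun τ _ hx => map_mem_pythagoreanClosure τ.toAlgHom hx,
      isHereditarilyNonPythagorean_of_field_fg hfg h2 _
        fun τ _ hx => map_mem_quadraticClosure τ.toAlgHom hx⟩
  · have hE : Finite E := by
      by_contra hE
      have := not_finite_iff_infinite.1 hE
      exact h (containsGlobalField_of_field_fg hfg)
    have : Algebra.IsAlgebraic E Ω := IsAlgClosure.isAlgebraic
    exact ⟨hE,
      (isQuadraticallyClosed_pythagoreanClosure h2).isHereditarilyQuadraticallyClosed E⟩
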